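/- Let $(X,Y)$ and $(X',Y')$ be real random vectors (possibly on different probability spaces) with $\mathrm E|Y|<\infty$ and $\mathrm E|Y'|<\infty$, such that the distribution functions $F_X$ and $F_{X'}$ are continuous. For $\alpha,t\in(0,1)$ let $\mathrm{VaR}_\alpha(X)=\inf\{x\in\mathbb R: F_X(x)\ge\alpha\}$, let $\mathrm{CoVaR}_{\alpha,t}(Y|X)=\inf\{y\in\mathbb R:\mathrm P(Y\le y\mid X\ge \mathrm{VaR}_\alpha(X))\ge t\}$, and for $\alpha\in(0,1)$, $\beta\in[0,1)$ let $$\mathrm{CoES}_{\alpha,\beta}(Y|X)=\frac1{1-\beta}\int_\beta^1\mathrm{CoVaR}_{\alpha,t}(Y|X)\,dt,\qquad \mathrm{MES}_\alpha(Y|X)=\mathrm E[Y\mid X\ge \mathrm{VaR}_\alpha(X)].$$ A copula is the joint distribution function $C$ on $[0,1]^2$ of two random variables that are uniform on $(0,1)$; it is a copula of $(X,Y)$ if $\mathrm P(X\le x,Y\le y)=C(F_X(x),F_Y(y))$ for all $x,y\in\mathbb R$. Write $(X,Y)\sim\mathcal E(\mu,\Sigma,R)$, where $\mu=(\mu_X,\mu_Y)$,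 $\sigma_X,\sigma_Y\ge0$, $\rho\in[-1,1]$ and $\Sigma=\begin{pmatrix}\sigma_X^2&\sigma_X\sigma_Y\rho\\ \sigma_X\sigma_Y\rho&\sigma_Y^2\end{pmatrix}$, if $(X,Y)^\top$ has the law of $\mu^\top+RAW^\top$ for some $A\in\mathbb R^{2\times2}$ with $AA^\top=\Sigma$, where $W$ is uniform on the Euclidean unit circle and $R\ge0$ is a random variable independent of $W$. An elliptical copula with dependence parameter $\rho$ and type $R$ is the copula of a distribution $\mathcal E(\mu,\Sigma,R)$ with continuous margins and this $\rho$; two elliptical copulas are of the same type if their radial parts $R$ have the same law. The Gumbel copula with parameter $\theta\in[1,\infty]$ is $C_\theta(u,v)=\exp\bigl(-((-\log u)^\theta+(-\log v)^\theta)^{1/\theta}\bigr)$ for $\theta<\infty$ and $C_\infty(u,v)=\min(u,v)$. Then the integrals defining $\mathrm{CoES}_{\alpha,\beta}(Y|X)$ and $\mathrm{CoES}_{\alpha,\beta}(Y'|X')$ converge for all $\alpha\in(0,1)$ and $\beta\in[0,1)$, and the following holds. (a) Suppose that at least one of the following conditions is satisfied: (i) $(X,Y)\sim\mathcal E(\mu,\Sigma,R)$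 and $(X',Y')\sim\mathcal E(\mu',\Sigma',R)$ with $\mu_Y\le\mu_{Y'}$, $\sigma_Y=\sigma_{Y'}$ and $\rho\le\rho'$; (ii) $(X,Y)$ and $(X',Y')$ have elliptical copulas of the same type with dependence parameters $\rho\le\rho'$, and $F_Y(y)\ge F_{Y'}(y)$ for all $y\in\mathbb R$; (iii) $(X,Y)$ and $(X',Y')$ have Gumbel copulas with parameters $\theta\le\theta'$, and $F_Y(y)\ge F_{Y'}(y)$ for all $y\in\mathbb R$. Then $\mathrm{CoES}_{\alpha,\beta}(Y|X)\le\mathrm{CoES}_{\alpha,\beta}(Y'|X')$ for all $\alpha,\beta\in(0,1)$, and $\mathrm{MES}_\alpha(Y|X)\le\mathrm{MES}_\alpha(Y'|X')$ for all $\alpha\in(0,1)$. (b) If $(X,Y)\sim\mathcal E(\mu,\Sigma,R)$ and $(X',Y')\sim\mathcal E(\mu',\Sigma',R)$ with $\mu_Y\le\mu_{Y'}$, $0<\sigma_Y\le\sigma_{Y'}$ and $\rho\le\rho'$, then $\mathrm{CoES}_{\alpha,\beta}(Y|X)\le\mathrm{CoES}_{\alpha,\beta}(Y'|X')$ for all $\alpha\in(0,1)$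 and all $\beta\in[\beta_0,1)$, where $\beta_0=\frac{1/2-C(\alpha,1/2)}{1-\alpha}$ and $C$ is the copula of $(X,Y)$. -/

import Mathlib

open MeasureTheory ProbabilityTheory
open scoped ENNReal

noncomputable section

/-- The generalized inverse `F^←(y) = inf {x | F x ≥ y}` of a function `F`. -/
def genInv (F : ℝ → ℝ) (y : ℝ) : ℝ := sInf {x : ℝ | y ≤ F x}

/-- Value-at-Risk at level `α`: the `α`-quantile of the distribution function of `X`. -/
def VaR {Ω : Type*} [MeasurableSpace Ω] (P : Measure Ω) (X : Ω → ℝ) (α : ℝ) : ℝ :=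
  genInv (cdf (P.map X)) α

/-- The elementary conditional probability given the stress event `{X ≥ VaR_α(X)}`. -/
def stressed {Ω : Type*} [MeasurableSpace Ω] (P : Measure Ω) (X : Ω → ℝ) (α : ℝ) : Measure Ω :=
  cond P {ω | VaR P X α ≤ X ω}

/-- `CoVaR_{α,β}(Y|X)`: the `β`-quantile of `Y` conditionally on `X ≥ VaR_α(X)`. -/
def CoVaR {Ω : Type*} [MeasurableSpace Ω] (P : Measure Ω) (Y X : Ω → ℝ) (α β : ℝ) : ℝ :=
  VaR (stressed P X α) Y β

/-- `CoES_{α,β}(Y|X) = (1 - β)⁻¹ ∫_β^1 CoVaR_{α,t}(Y|X) dt`. -/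
def CoES {Ω : Type*} [MeasurableSpace Ω] (P : Measure Ω) (Y X : Ω → ℝ) (α β : ℝ) : ℝ :=
  1 / (1 - β) * ∫ t in β..1, CoVaR P Y X α t

/-- Marginal Expected Shortfall `MES_α(Y|X) = E[Y | X ≥ VaR_α(X)]`. -/
def MES {Ω : Type*} [MeasurableSpace Ω] (P : Measure Ω) (Y X : Ω → ℝ) (α : ℝ) : ℝ :=
  ∫ ω, Y ω ∂(stressed P X α)

/-- The joint law of `(X, Y)` under `P`. -/
def jointLaw {Ω : Type*} [MeasurableSpace Ω] (P : Measure Ω) (X Y : Ω → ℝ) : Measure (ℝ × ℝ) :=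
  P.map (fun ω => (X ω, Y ω))

/-- The joint distribution function `(x, y) ↦ Q((-∞, x] × (-∞, y])` of a law on the plane. -/
def jointCDF (Q : Measure (ℝ × ℝ)) (x y : ℝ) : ℝ := Q.real (Set.Iic x ×ˢ Set.Iic y)

/-- `C` is (on the unit square, where its values matter) the joint distribution function of a pair
`(U, V)` of random variables that are uniformly distributed on the unit interval. -/
def IsCopula (C : ℝ → ℝ → ℝ) : Prop :=
  ∃ c : Measure (ℝ × ℝ),
    c.map Prod.fst = volume.restrict (Set.Icc (0 : ℝ) 1) ∧
    c.map Prod.snd = volume.restrict (Set.Icc (0 : ℝ) 1) ∧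
    ∀ u ∈ Set.Icc (0 : ℝ) 1, ∀ v ∈ Set.Icc (0 : ℝ) 1, C u v = jointCDF c u v

/-- `C` is a copula of the law `Q`: the joint distribution function of `Q` at `(x, y)` is
`C (F₁ x) (F₂ y)`, where `F₁`, `F₂` are the marginal distribution functions of `Q`. -/
def IsCopulaOf (C : ℝ → ℝ → ℝ) (Q : Measure (ℝ × ℝ)) : Prop :=
  IsCopula C ∧
    ∀ x y : ℝ, jointCDF Q x y = C (cdf (Q.map Prod.fst) x) (cdf (Q.map Prod.snd) y)

/-- The uniform distribution on the Euclidean unit circle: the law of `(cos φ, sin φ)` with `φ`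
uniform on `[0, 2π)`. -/
def uniformCircle : Measure (ℝ × ℝ) :=
  (cond volume (Set.Ico (0 : ℝ) (2 * Real.pi))).map (fun φ => (Real.cos φ, Real.sin φ))

/-- The law of `m + R • A W` where `W` is uniform on the unit circle and `R`, independent of `W`,
has law `ν`. -/
def ellipticalLaw (mX mY : ℝ) (A : Matrix (Fin 2) (Fin 2) ℝ) (ν : Measure ℝ) : Measure (ℝ × ℝ) :=
  (ν.prod uniformCircle).map (fun q =>
    (mX + q.1 * (A 0 0 * q.2.1 + A 0 1 * q.2.2), mY + q.1 * (A 1 0 * q.2.1 + A 1 1 * q.2.2)))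

/-- `Q` is the elliptical distribution with location `(mX, mY)`, ellipticity matrix
`Σ = [[σX², σX σY ρ], [σX σY ρ, σY²]]`, and radial part a non-negative random variable of
law `ν`. -/
structure IsElliptical (Q : Measure (ℝ × ℝ)) (mX mY σX σY ρ : ℝ) (ν : Measure ℝ) : Prop where
  isProbabilityMeasure_radial : IsProbabilityMeasure ν
  radial_nonneg : ∀ᵐ r ∂ν, 0 ≤ r
  scaleX_nonneg : 0 ≤ σX
  scaleY_nonneg : 0 ≤ σY
  rho_mem : ρ ∈ Set.Icc (-1 : ℝ) 1
  law_eq : ∃ A : Matrix (Fin 2) (Fin 2) ℝ,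
    A * A.transpose = !![σX ^ 2, σX * σY * ρ; σX * σY * ρ, σY ^ 2] ∧
      Q = ellipticalLaw mX mY A ν

/-- `C` is an elliptical copula with dependence parameter `ρ` and type `ν`: a copula of an
elliptical distribution with continuous margins, dependence parameter `ρ` and radial part of law
`ν`. -/
def IsEllipticalCopula (C : ℝ → ℝ → ℝ) (ρ : ℝ) (ν : Measure ℝ) : Prop :=
  ∃ (Q : Measure (ℝ × ℝ)) (mX mY σX σY : ℝ),
    IsElliptical Q mX mY σX σY ρ ν ∧
    Continuous (cdf (Q.map Prod.fst)) ∧ Continuous (cdf (Q.map Prod.snd)) ∧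
    IsCopulaOf C Q

/-- The Gumbel copula with parameter `θ ∈ [1, ∞]`, on the unit square:
`exp (-((-log u)^θ + (-log v)^θ)^(1/θ))` for finite `θ`, extended by `0` where `u = 0` or `v = 0`,
and `min u v` for `θ = ∞`. -/
def gumbelCopula (θ : ℝ≥0∞) (u v : ℝ) : ℝ :=
  if θ = ⊤ then min u v
  else if u ≤ 0 ∨ v ≤ 0 then 0
  else Real.exp (-(((-Real.log u) ^ θ.toReal + (-Real.log v) ^ θ.toReal) ^ (1 / θ.toReal)))

end

/-!
The integrals are finite because `t ↦ CoVaR_{α,t}(Y|X)` is the quantile function of `Y` under the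
conditional probability given the stress event, and a quantile function evaluated at a uniform
variable has the law it came from (`map_genInv_cdf`). In particular `MES` is the integral of
`CoVaR` over all levels, and both orderings in (a) follow once the conditional laws of `Y` and `Y'`
are stochastically ordered.

As `X` has no atoms, the conditional distribution function of `Y` at `y` is
`(v - C α v) / (1 - α)` with `v = F_Y y` (`cdf_map_stressed`). It decreases when `C` increases
pointwise, and when `v` decreases (`IsCopula.sub_le_sub`). It remains to compare copulas. For Gumbel
copulas this is the monotonicity of `ℓ^θ` norms. For elliptical laws the quadrant probabilities of
two projections of a spherical law `R W` must be shown to increase as the directions of the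
projections approach each other (`measureReal_quadrant_mono`): the reflection that exchanges the old
and the new second direction preserves the spherical law, and it maps the part of the old quadrant
that is lost into the part of the new one that is gained.

In (b), `β₀` is the conditional probability that `Y` is at most its location parameter. Above this
level the standardized conditional quantile is positive, so that a larger scale, too, increases the
quantile (`IsElliptical.CoVaR_le`).
-/

/-! ### Quantile functions -/

section Quantile

open Filter Topology

variable {μ : Measure ℝ}

/-- The Galois connection between a distribution function and its generalized inverse. -/
theorem genInv_cdf_le_iff (μ : Measure ℝ) {t : ℝ} (ht : t ∈ Set.Ioo (0 : ℝ) 1) (y : ℝ) :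
    genInv (cdf μ) t ≤ y ↔ t ≤ cdf μ y := by
  have hne : {x : ℝ | t ≤ cdf μ x}.Nonempty :=
    (((tendsto_cdf_atTop μ).eventually (lt_mem_nhds ht.2)).exists).imp fun _ h => le_of_lt h
  have hbdd : BddBelow {x : ℝ | t ≤ cdf μ x} := by
    obtain ⟨b, hb⟩ := ((tendsto_cdf_atBot μ).eventually (gt_mem_nhds ht.1)).exists
    refine ⟨b, fun x hx => le_of_not_gt fun hxb => ?_⟩
    have hx : t ≤ cdf μ x := hx
    linarith [monotone_cdf μ hxb.le]
  refine ⟨fun h => ?_, fun h => csInf_le hbdd h⟩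
  -- Every point to the right of the infimum satisfies the bound; pass to the limit from the right.
  have hright : ∀ x ∈ Set.Ioi y, t ≤ cdf μ x := fun x hx => by
    obtain ⟨z, hz, hzx⟩ := exists_lt_of_csInf_lt hne (lt_of_le_of_lt h hx)
    exact le_trans hz (monotone_cdf μ hzx.le)
  have hcont : Tendsto (cdf μ) (𝓝[>] y) (𝓝 (cdf μ y)) :=
    ((cdf μ).right_continuous y).mono_left (nhdsWithin_mono _ Set.Ioi_subset_Ici_self)
  exact ge_of_tendsto hcont (eventually_mem_nhdsWithin.mono hright)

theorem cdf_genInv_of_continuous (μ : Measure ℝ) (hμ : Continuous (cdf μ)) {t : ℝ}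
    (ht : t ∈ Set.Ioo (0 : ℝ) 1) : cdf μ (genInv (cdf μ) t) = t := by
  refine le_antisymm ?_ ((genInv_cdf_le_iff μ ht _).1 le_rfl)
  have hleft : ∀ x ∈ Set.Iio (genInv (cdf μ) t), cdf μ x ≤ t := fun x hx =>
    (lt_of_not_ge fun h => (not_lt.2 ((genInv_cdf_le_iff μ ht x).2 h)) hx).le
  exact le_of_tendsto (hμ.continuousAt.mono_left nhdsWithin_le_nhds)
    (eventually_mem_nhdsWithin.mono hleft)

theorem monotoneOn_genInv_cdf (μ : Measure ℝ) :
    MonotoneOn (genInv (cdf μ)) (Set.Ioo 0 1) := fun _ hs _ ht hst =>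
  (genInv_cdf_le_iff μ hs _).2 (hst.trans ((genInv_cdf_le_iff μ ht _).1 le_rfl))

theorem aemeasurable_genInv_cdf (μ : Measure ℝ) :
    AEMeasurable (genInv (cdf μ)) (volume.restrict (Set.Ioo 0 1)) :=
  aemeasurable_restrict_of_monotoneOn measurableSet_Ioo (monotoneOn_genInv_cdf μ)

/-- The quantile transform: the quantile function of `μ`, evaluated at a uniform random variable,
has law `μ`. -/
theorem map_genInv_cdf (μ : Measure ℝ) [IsProbabilityMeasure μ] :
    (volume.restrict (Set.Ioo (0 : ℝ) 1)).map (genInv (cdf μ)) = μ := by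
  have hU : IsProbabilityMeasure (volume.restrict (Set.Ioo (0 : ℝ) 1)) := ⟨by simp⟩
  have := Measure.isProbabilityMeasure_map (aemeasurable_genInv_cdf μ)
  refine Measure.ext_of_Iic _ _ fun y => ?_
  rw [Measure.map_apply_of_aemeasurable (aemeasurable_genInv_cdf μ) measurableSet_Iic,
    Measure.restrict_apply' measurableSet_Ioo]
  have hset : genInv (cdf μ) ⁻¹' Set.Iic y ∩ Set.Ioo 0 1 = Set.Iic (cdf μ y) ∩ Set.Ioo 0 1 := by
    ext t
    simp only [Set.mem_inter_iff, Set.mem_preimage, Set.mem_Iic]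
    exact and_congr_left fun ht => genInv_cdf_le_iff μ ht y
  rw [hset, ← ofReal_cdf]
  -- The endpoint `1` is added so that the intersection is an interval also when `cdf μ y = 1`.
  have hae : (Set.Iic (cdf μ y) ∩ Set.Ioo 0 1 : Set ℝ) =ᵐ[volume]
      (Set.Iic (cdf μ y) ∩ Set.Ioc 0 1 : Set ℝ) := (ae_eq_refl _).inter Ioo_ae_eq_Ioc
  rw [measure_congr hae, Set.inter_comm, Set.Ioc_inter_Iic, min_eq_right (cdf_le_one μ y),
    Real.volume_Ioc, sub_zero]

theorem integrableOn_genInv_cdf (μ : Measure ℝ) [IsProbabilityMeasure μ]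
    (hμ : Integrable (fun x => x) μ) : IntegrableOn (genInv (cdf μ)) (Set.Ioo 0 1) := by
  rw [← map_genInv_cdf μ] at hμ
  exact (integrable_map_measure aestronglyMeasurable_id (aemeasurable_genInv_cdf μ)).1 hμ

theorem setIntegral_genInv_cdf (μ : Measure ℝ) [IsProbabilityMeasure μ] :
    ∫ t in Set.Ioo 0 1, genInv (cdf μ) t = ∫ x, x ∂μ := by
  conv_rhs => rw [← map_genInv_cdf μ]
  exact (integral_map (aemeasurable_genInv_cdf μ) aestronglyMeasurable_id).symm

theorem genInv_cdf_comp_affine {μ κ : Measure ℝ} {m σ : ℝ} (hσ : 0 < σ)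
    (h : ∀ x, cdf μ x = cdf κ ((x - m) / σ)) {t : ℝ} (ht : t ∈ Set.Ioo (0 : ℝ) 1) :
    genInv (cdf μ) t = m + σ * genInv (cdf κ) t := by
  refine eq_of_forall_ge_iff fun y => ?_
  rw [genInv_cdf_le_iff μ ht, h, ← genInv_cdf_le_iff κ ht, le_div_iff₀ hσ, mul_comm,
    le_sub_iff_add_le']

theorem measure_singleton_of_continuous_cdf [IsProbabilityMeasure μ] (hμ : Continuous (cdf μ))
    (x : ℝ) : μ {x} = 0 := by
  rw [← measure_cdf μ, StieltjesFunction.measure_singleton, hμ.continuousWithinAt.leftLim_eq]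
  simp

end Quantile

/-! ### Risk measures under the stress event -/

section Stress

variable {Ω Ω' : Type*} [MeasurableSpace Ω] [MeasurableSpace Ω']
  {P : Measure Ω} {P' : Measure Ω'}
  {X Y : Ω → ℝ} {X' Y' : Ω' → ℝ} {α : ℝ}

theorem jointCDF_jointLaw (hX : Measurable X) (hY : Measurable Y) (x y : ℝ) :
    jointCDF (jointLaw P X Y) x y = P.real {ω | X ω ≤ x ∧ Y ω ≤ y} := by
  rw [jointCDF, jointLaw, map_measureReal_apply (hX.prodMk hY)
    (measurableSet_Iic.prod measurableSet_Iic)]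
  rfl

theorem cdf_VaR (hFX : Continuous (cdf (P.map X))) (hα : α ∈ Set.Ioo (0 : ℝ) 1) :
    cdf (P.map X) (VaR P X α) = α :=
  cdf_genInv_of_continuous _ hFX hα

theorem CoVaR_le_of_forall {t : ℝ} (ht : t ∈ Set.Ioo (0 : ℝ) 1)
    (h : ∀ y, t ≤ cdf ((stressed P' X' α).map Y') y → t ≤ cdf ((stressed P X α).map Y) y) :
    CoVaR P Y X α t ≤ CoVaR P' Y' X' α t :=
  (genInv_cdf_le_iff _ ht _).2 (h _ ((genInv_cdf_le_iff _ ht _).1 le_rfl))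

theorem CoES_le_of_CoVaR_le {β : ℝ} (hβ : β ∈ Set.Ico (0 : ℝ) 1)
    (hi : IntervalIntegrable (fun t => CoVaR P Y X α t) volume 0 1)
    (hi' : IntervalIntegrable (fun t => CoVaR P' Y' X' α t) volume 0 1)
    (h : ∀ t ∈ Set.Ioo β 1, CoVaR P Y X α t ≤ CoVaR P' Y' X' α t) :
    CoES P Y X α β ≤ CoES P' Y' X' α β := by
  have hsub : Set.uIcc β 1 ⊆ Set.uIcc 0 1 := by
    rw [Set.uIcc_of_le hβ.2.le, Set.uIcc_of_le zero_le_one]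
    exact Set.Icc_subset_Icc_left hβ.1
  refine mul_le_mul_of_nonneg_left ?_ (one_div_nonneg.2 (sub_nonneg.2 hβ.2.le))
  exact intervalIntegral.integral_mono_on_of_le_Ioo hβ.2.le (hi.mono_set hsub)
    (hi'.mono_set hsub) h

theorem integrable_stressed (hYint : Integrable Y P) : Integrable Y (stressed P X α) := by
  unfold stressed ProbabilityTheory.cond
  by_cases h : P {ω | VaR P X α ≤ X ω} = 0
  · simp [Measure.restrict_eq_zero.2 h]
  · exact hYint.integrableOn.smul_measure (ENNReal.inv_ne_top.2 h)

variable [IsProbabilityMeasure P] [IsProbabilityMeasure P']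

theorem cdf_map_eq_real (hX : Measurable X) (x : ℝ) :
    cdf (P.map X) x = P.real {ω | X ω ≤ x} := by
  have := Measure.isProbabilityMeasure_map (μ := P) hX.aemeasurable
  rw [cdf_eq_real, map_measureReal_apply hX measurableSet_Iic]
  rfl

/-- An atomless `X` exceeds its `α`-quantile with probability `1 - α`, whether or not the
quantile itself is counted. -/
theorem stress_event_ae_eq (hX : Measurable X) (hFX : Continuous (cdf (P.map X))) :
    {ω | VaR P X α ≤ X ω} =ᵐ[P] {ω | VaR P X α < X ω} := by
  have := Measure.isProbabilityMeasure_map (μ := P) hX.aemeasurable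
  have h0 : P (X ⁻¹' {VaR P X α}) = 0 := by
    rw [← Measure.map_apply hX (measurableSet_singleton _)]
    exact measure_singleton_of_continuous_cdf hFX _
  have hne : ∀ᵐ ω ∂P, X ω ≠ VaR P X α := by
    simp only [ae_iff, not_not]
    exact h0
  filter_upwards [hne] with ω hω
  exact propext ⟨fun h => lt_of_le_of_ne h hω.symm, fun h => le_of_lt h⟩

theorem real_stress_event (hX : Measurable X) (hFX : Continuous (cdf (P.map X)))
    (hα : α ∈ Set.Ioo (0 : ℝ) 1) : P.real {ω | VaR P X α ≤ X ω} = 1 - α := by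
  rw [measureReal_congr (stress_event_ae_eq hX hFX)]
  have hcompl : {ω | VaR P X α < X ω} = {ω | X ω ≤ VaR P X α}ᶜ := by ext; simp
  rw [hcompl, probReal_compl_eq_one_sub (measurableSet_le hX measurable_const),
    ← cdf_map_eq_real hX, cdf_VaR hFX hα]

theorem isProbabilityMeasure_stressed (hX : Measurable X) (hFX : Continuous (cdf (P.map X)))
    (hα : α ∈ Set.Ioo (0 : ℝ) 1) : IsProbabilityMeasure (stressed P X α) := by
  refine cond_isProbabilityMeasure fun h0 => ?_
  have := real_stress_event hX hFX hα
  rw [measureReal_def, h0, ENNReal.toReal_zero] at this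
  linarith [hα.2]

/-- The conditional distribution function of `Y` given the stress event, in terms of the marginal
and the joint distribution functions. -/
theorem cdf_map_stressed (hX : Measurable X) (hY : Measurable Y)
    (hFX : Continuous (cdf (P.map X))) (hα : α ∈ Set.Ioo (0 : ℝ) 1) (y : ℝ) :
    cdf ((stressed P X α).map Y) y =
      (cdf (P.map Y) y - jointCDF (jointLaw P X Y) (VaR P X α) y) / (1 - α) := by
  have := isProbabilityMeasure_stressed hX hFX hα
  rw [cdf_map_eq_real hY, cdf_map_eq_real hY, jointCDF_jointLaw hX hY, stressed,
    measureReal_def, cond_apply (measurableSet_le measurable_const hX), ENNReal.toReal_mul,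
    ENNReal.toReal_inv, ← measureReal_def, ← measureReal_def, real_stress_event hX hFX hα,
    ← div_eq_inv_mul]
  congr 1
  have hstress : ({ω | VaR P X α ≤ X ω} ∩ {ω | Y ω ≤ y} : Set Ω) =ᵐ[P]
      ({ω | VaR P X α < X ω} ∩ {ω | Y ω ≤ y} : Set Ω) :=
    (stress_event_ae_eq hX hFX).inter (ae_eq_refl _)
  rw [measureReal_congr hstress, eq_sub_iff_add_eq, ← measureReal_union]
  · congr 1
    ext ω
    simp only [Set.mem_union, Set.mem_inter_iff, Set.mem_ofPred_eq]
    rcases lt_or_ge (VaR P X α) (X ω) with h | h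
    · simp [h]
    · simp [h, h.not_gt]
  · refine Set.disjoint_left.2 fun ω h h' => ?_
    exact not_lt.2 h'.1 h.1
  · exact (hX measurableSet_Iic).inter (hY measurableSet_Iic)

theorem intervalIntegrable_CoVaR (hX : Measurable X) (hY : Measurable Y) (hYint : Integrable Y P)
    (hFX : Continuous (cdf (P.map X))) (hα : α ∈ Set.Ioo (0 : ℝ) 1) :
    IntervalIntegrable (fun t => CoVaR P Y X α t) volume 0 1 := by
  have := isProbabilityMeasure_stressed hX hFX hα
  have := Measure.isProbabilityMeasure_map (μ := stressed P X α) hY.aemeasurable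
  rw [intervalIntegrable_iff_integrableOn_Ioo_of_le zero_le_one]
  exact integrableOn_genInv_cdf _
    ((integrable_map_measure aestronglyMeasurable_id hY.aemeasurable).2
      (integrable_stressed hYint))

theorem MES_eq_integral_CoVaR (hX : Measurable X) (hY : Measurable Y)
    (hFX : Continuous (cdf (P.map X))) (hα : α ∈ Set.Ioo (0 : ℝ) 1) :
    MES P Y X α = ∫ t in (0 : ℝ)..1, CoVaR P Y X α t := by
  have := isProbabilityMeasure_stressed hX hFX hα
  have := Measure.isProbabilityMeasure_map (μ := stressed P X α) hY.aemeasurable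
  rw [intervalIntegral.integral_of_le zero_le_one, integral_Ioc_eq_integral_Ioo]
  refine Eq.trans ?_ (setIntegral_genInv_cdf ((stressed P X α).map Y)).symm
  exact (integral_map (f := fun x : ℝ => x) hY.aemeasurable aestronglyMeasurable_id).symm

/-- Stochastic dominance of the conditional law of `Y'` over that of `Y` orders the conditional
expected shortfalls and the marginal expected shortfalls. -/
theorem CoES_le_and_MES_le_of_cdf_le
    (hX : Measurable X) (hY : Measurable Y) (hX' : Measurable X') (hY' : Measurable Y')
    (hYint : Integrable Y P) (hYint' : Integrable Y' P')
    (hFX : Continuous (cdf (P.map X))) (hFX' : Continuous (cdf (P'.map X')))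
    (h : ∀ α ∈ Set.Ioo (0 : ℝ) 1, ∀ y,
      cdf ((stressed P' X' α).map Y') y ≤ cdf ((stressed P X α).map Y) y) :
    (∀ α ∈ Set.Ioo (0 : ℝ) 1, ∀ β ∈ Set.Ioo (0 : ℝ) 1, CoES P Y X α β ≤ CoES P' Y' X' α β) ∧
      (∀ α ∈ Set.Ioo (0 : ℝ) 1, MES P Y X α ≤ MES P' Y' X' α) := by
  have hle : ∀ α ∈ Set.Ioo (0 : ℝ) 1, ∀ t ∈ Set.Ioo (0 : ℝ) 1,
      CoVaR P Y X α t ≤ CoVaR P' Y' X' α t := fun α hα t ht =>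
    CoVaR_le_of_forall ht fun y hy => hy.trans (h α hα y)
  refine ⟨fun α hα β hβ => ?_, fun α hα => ?_⟩
  · exact CoES_le_of_CoVaR_le ⟨hβ.1.le, hβ.2⟩ (intervalIntegrable_CoVaR hX hY hYint hFX hα)
      (intervalIntegrable_CoVaR hX' hY' hYint' hFX' hα)
      fun t ht => hle α hα t ⟨hβ.1.trans ht.1, ht.2⟩
  · rw [MES_eq_integral_CoVaR hX hY hFX hα, MES_eq_integral_CoVaR hX' hY' hFX' hα]
    exact intervalIntegral.integral_mono_on_of_le_Ioo zero_le_one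
      (intervalIntegrable_CoVaR hX hY hYint hFX hα)
      (intervalIntegrable_CoVaR hX' hY' hYint' hFX' hα) (hle α hα)

end Stress

/-! ### Copulas and the concordance order -/

section Copula

theorem real_Iic_uniform {v : ℝ} (hv : v ∈ Set.Icc (0 : ℝ) 1) :
    (volume.restrict (Set.Icc (0 : ℝ) 1)).real (Set.Iic v) = v := by
  rw [measureReal_restrict_apply measurableSet_Iic, Set.inter_comm, ← Set.Ici_inter_Iic,
    Set.inter_assoc, Set.Iic_inter_Iic, min_eq_right hv.2, Set.Ici_inter_Iic,
    Real.volume_real_Icc_of_le hv.1, sub_zero]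

namespace IsCopula

variable {C : ℝ → ℝ → ℝ} {u v w : ℝ}

/-- For fixed `u`, the function `v ↦ v - C u v` is the distribution function of the second
coordinate on the event that the first coordinate exceeds `u`; in particular it is monotone. -/
theorem sub_le_sub (hC : IsCopula C) (hu : u ∈ Set.Icc (0 : ℝ) 1) (hv : v ∈ Set.Icc (0 : ℝ) 1)
    (hw : w ∈ Set.Icc (0 : ℝ) 1) (hvw : v ≤ w) : v - C u v ≤ w - C u w := by
  obtain ⟨c, h1, h2, hc⟩ := hC
  have : IsFiniteMeasure (c.map Prod.fst) := by rw [h1]; infer_instance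
  have : IsFiniteMeasure c := Measure.isFiniteMeasure_of_map measurable_fst.aemeasurable
  have key : ∀ z ∈ Set.Icc (0 : ℝ) 1, z - C u z = c.real (Set.Ioi u ×ˢ Set.Iic z) := by
    intro z hz
    have hz2 : z = c.real (Prod.snd ⁻¹' Set.Iic z) := by
      rw [← map_measureReal_apply measurable_snd measurableSet_Iic, h2, real_Iic_uniform hz]
    rw [hc u hu z hz, jointCDF, sub_eq_iff_eq_add, ← measureReal_union]
    · rw [← Set.union_prod, Set.union_comm, Set.Iic_union_Ioi, Set.univ_prod, ← hz2]
    · exact Set.Disjoint.set_prod_left (Set.Iic_disjoint_Ioi le_rfl).symm _ _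
    · exact measurableSet_Iic.prod measurableSet_Iic
  rw [key v hv, key w hw]
  exact measureReal_mono (Set.prod_mono subset_rfl (Set.Iic_subset_Iic.2 hvw))

theorem nonneg (hC : IsCopula C) (hu : u ∈ Set.Icc (0 : ℝ) 1) (hv : v ∈ Set.Icc (0 : ℝ) 1) :
    0 ≤ C u v := by
  obtain ⟨c, -, -, hc⟩ := hC
  rw [hc u hu v hv]
  exact measureReal_nonneg

theorem le_left (hC : IsCopula C) (hu : u ∈ Set.Icc (0 : ℝ) 1) (hv : v ∈ Set.Icc (0 : ℝ) 1) :
    C u v ≤ u := by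
  obtain ⟨c, h1, -, hc⟩ := hC
  have : IsFiniteMeasure (c.map Prod.fst) := by rw [h1]; infer_instance
  have : IsFiniteMeasure c := Measure.isFiniteMeasure_of_map measurable_fst.aemeasurable
  calc C u v = c.real (Set.Iic u ×ˢ Set.Iic v) := hc u hu v hv
    _ ≤ c.real (Prod.fst ⁻¹' Set.Iic u) := measureReal_mono fun _ h => h.1
    _ = u := by rw [← map_measureReal_apply measurable_fst measurableSet_Iic, h1,
      real_Iic_uniform hu]

theorem le_right (hC : IsCopula C) (hu : u ∈ Set.Icc (0 : ℝ) 1) (hv : v ∈ Set.Icc (0 : ℝ) 1) :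
    C u v ≤ v := by
  obtain ⟨c, -, h2, hc⟩ := hC
  have : IsFiniteMeasure (c.map Prod.snd) := by rw [h2]; infer_instance
  have : IsFiniteMeasure c := Measure.isFiniteMeasure_of_map measurable_snd.aemeasurable
  calc C u v = c.real (Set.Iic u ×ˢ Set.Iic v) := hc u hu v hv
    _ ≤ c.real (Prod.snd ⁻¹' Set.Iic v) := measureReal_mono fun _ h => h.2
    _ = v := by rw [← map_measureReal_apply measurable_snd measurableSet_Iic, h2,
      real_Iic_uniform hv]

theorem apply_zero_right (hC : IsCopula C) (hu : u ∈ Set.Icc (0 : ℝ) 1) : C u 0 = 0 :=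
  le_antisymm (hC.le_right hu ⟨le_rfl, zero_le_one⟩) (hC.nonneg hu ⟨le_rfl, zero_le_one⟩)

theorem apply_one_right (hC : IsCopula C) (hu : u ∈ Set.Icc (0 : ℝ) 1) : C u 1 = u := by
  refine le_antisymm (hC.le_left hu ⟨zero_le_one, le_rfl⟩) ?_
  obtain ⟨c, h1, h2, hc⟩ := hC
  have : IsFiniteMeasure (c.map Prod.fst) := by rw [h1]; infer_instance
  have : IsFiniteMeasure c := Measure.isFiniteMeasure_of_map measurable_fst.aemeasurable
  have hle : ∀ᵐ p ∂c, p.2 ≤ 1 := by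
    have h : ∀ᵐ z ∂(c.map Prod.snd), z ≤ 1 := by
      rw [h2]
      exact (ae_restrict_mem measurableSet_Icc).mono fun _ h => h.2
    exact ae_of_ae_map measurable_snd.aemeasurable h
  have hsub : (Prod.fst ⁻¹' Set.Iic u : Set (ℝ × ℝ)) ≤ᵐ[c]
      (Set.Iic u ×ˢ Set.Iic 1 : Set (ℝ × ℝ)) :=
    hle.mono fun _ hp hu => ⟨hu, hp⟩
  calc u = c.real (Prod.fst ⁻¹' Set.Iic u) := by
        rw [← map_measureReal_apply measurable_fst measurableSet_Iic, h1, real_Iic_uniform hu]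
    _ ≤ c.real (Set.Iic u ×ˢ Set.Iic 1) :=
        ENNReal.toReal_mono (measure_ne_top _ _) (measure_mono_ae hsub)
    _ = C u 1 := (hc u hu 1 ⟨zero_le_one, le_rfl⟩).symm

end IsCopula

variable {Ω Ω' : Type*} [MeasurableSpace Ω] [MeasurableSpace Ω']
  {P : Measure Ω} {P' : Measure Ω'}
  {X Y : Ω → ℝ} {X' Y' : Ω' → ℝ} {C C' : ℝ → ℝ → ℝ}

theorem map_fst_jointLaw (hX : Measurable X) (hY : Measurable Y) :
    (jointLaw P X Y).map Prod.fst = P.map X :=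
  Measure.map_map measurable_fst (hX.prodMk hY)

theorem map_snd_jointLaw (hX : Measurable X) (hY : Measurable Y) :
    (jointLaw P X Y).map Prod.snd = P.map Y :=
  Measure.map_map measurable_snd (hX.prodMk hY)

theorem IsCopulaOf.jointCDF_VaR {α : ℝ} (hC : IsCopulaOf C (jointLaw P X Y)) (hX : Measurable X)
    (hY : Measurable Y) (hFX : Continuous (cdf (P.map X))) (hα : α ∈ Set.Ioo (0 : ℝ) 1) (y : ℝ) :
    jointCDF (jointLaw P X Y) (VaR P X α) y = C α (cdf (P.map Y) y) := by
  rw [hC.2, map_fst_jointLaw hX hY, map_snd_jointLaw hX hY, cdf_VaR hFX hα]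

variable [IsProbabilityMeasure P] [IsProbabilityMeasure P']

/-- A larger copula (in the concordance order) and a stochastically larger second margin make the
conditional law of the second component, given that the first one is in stress, stochastically
larger. -/
theorem cdf_stressed_le_of_copula_le
    (hX : Measurable X) (hY : Measurable Y) (hX' : Measurable X') (hY' : Measurable Y')
    (hFX : Continuous (cdf (P.map X))) (hFX' : Continuous (cdf (P'.map X')))
    (hC : IsCopulaOf C (jointLaw P X Y)) (hC' : IsCopulaOf C' (jointLaw P' X' Y'))
    (hle : ∀ u ∈ Set.Ioo (0 : ℝ) 1, ∀ v ∈ Set.Ioo (0 : ℝ) 1, C u v ≤ C' u v)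
    (hF : ∀ y : ℝ, cdf (P'.map Y') y ≤ cdf (P.map Y) y) {α : ℝ} (hα : α ∈ Set.Ioo (0 : ℝ) 1)
    (y : ℝ) : cdf ((stressed P' X' α).map Y') y ≤ cdf ((stressed P X α).map Y) y := by
  have hα' := Set.Ioo_subset_Icc_self hα
  have hv : ∀ μ : Measure ℝ, cdf μ y ∈ Set.Icc (0 : ℝ) 1 := fun μ =>
    ⟨cdf_nonneg μ y, cdf_le_one μ y⟩
  rw [cdf_map_stressed hX hY hFX hα, cdf_map_stressed hX' hY' hFX' hα,
    hC.jointCDF_VaR hX hY hFX hα, hC'.jointCDF_VaR hX' hY' hFX' hα]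
  refine div_le_div_of_nonneg_right ?_ (sub_nonneg.2 hα.2.le)
  refine le_trans ?_ (hC.1.sub_le_sub hα' (hv _) (hv _) (hF y))
  refine sub_le_sub_left ?_ _
  -- On the boundary of the unit square all copulas agree.
  rcases (hv (P'.map Y')).1.eq_or_lt with h0 | h0
  · rw [← h0, hC.1.apply_zero_right hα', hC'.1.apply_zero_right hα']
  rcases (hv (P'.map Y')).2.eq_or_lt with h1 | h1
  · rw [h1, hC.1.apply_one_right hα', hC'.1.apply_one_right hα']
  exact hle α hα _ ⟨h0, h1⟩

end Copula

/-! ### Gumbel copulas -/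

/-- Gumbel copulas increase with their parameter because the `ℓ^θ` norm of a vector decreases
with `θ`; the comparison with `θ' = ∞` is the Fréchet–Hoeffding upper bound. -/
theorem gumbelCopula_le_gumbelCopula {θ θ' : ℝ≥0∞} (hθ : 1 ≤ θ) (hθθ' : θ ≤ θ')
    (hC : IsCopula (gumbelCopula θ)) {u v : ℝ} (hu : u ∈ Set.Ioo (0 : ℝ) 1)
    (hv : v ∈ Set.Ioo (0 : ℝ) 1) : gumbelCopula θ u v ≤ gumbelCopula θ' u v := by
  by_cases hθ' : θ' = ⊤
  · have hmin : gumbelCopula θ' u v = min u v := if_pos hθ'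
    rw [hmin]
    have hu' := Set.Ioo_subset_Icc_self hu
    have hv' := Set.Ioo_subset_Icc_self hv
    exact le_min (hC.le_left hu' hv') (hC.le_right hu' hv')
  · have hθtop : θ ≠ ⊤ := ne_top_of_le_ne_top hθ' hθθ'
    have huv : ¬(u ≤ 0 ∨ v ≤ 0) := not_or.2 ⟨not_le.2 hu.1, not_le.2 hv.1⟩
    simp only [gumbelCopula, if_neg hθ', if_neg hθtop, if_neg huv]
    have hpos : 0 < θ.toReal := ENNReal.toReal_pos (one_pos.trans_le hθ).ne' hθtop
    exact Real.exp_le_exp.2 (neg_le_neg (Real.rpow_add_rpow_le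
      (neg_nonneg.2 (Real.log_nonpos hu.1.le hu.2.le))
      (neg_nonneg.2 (Real.log_nonpos hv.1.le hv.2.le)) hpos (ENNReal.toReal_mono hθ' hθθ')))

/-! ### Reflections of the plane and the spherical law -/

section Spherical

open Real

/-- The coordinate of `z` along the unit vector `(cos τ, sin τ)`. -/
noncomputable def proj (τ : ℝ) (z : ℝ × ℝ) : ℝ := cos τ * z.1 + sin τ * z.2

/-- The reflection of the plane that sends the direction with angle `τ` to the direction with
angle `c - τ`. -/
noncomputable def reflection (c : ℝ) (z : ℝ × ℝ) : ℝ × ℝ :=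
  (cos c * z.1 + sin c * z.2, sin c * z.1 - cos c * z.2)

/-- The law of `R W`, where `W` is uniform on the unit circle and `R` is an independent random
variable with law `ν`. -/
noncomputable def sphericalLaw (ν : Measure ℝ) : Measure (ℝ × ℝ) :=
  (ν.prod uniformCircle).map (fun q => (q.1 * q.2.1, q.1 * q.2.2))

theorem measurable_proj (τ : ℝ) : Measurable (proj τ) := by unfold proj; fun_prop

theorem measurable_reflection (c : ℝ) : Measurable (reflection c) := by
  unfold reflection; fun_prop

@[simp] theorem proj_zero (z : ℝ × ℝ) : proj 0 z = z.1 := by simp [proj]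

theorem proj_reflection (τ c : ℝ) (z : ℝ × ℝ) : proj τ (reflection c z) = proj (c - τ) z := by
  simp only [proj, reflection, cos_sub, sin_sub]
  ring

/-- The reflection with index `τ + τ'` exchanges the directions `τ` and `τ'`. If `τ'` is the one
closer to the first axis, then a point on the side of `τ` of the mirror is moved to the right. -/
theorem fst_le_fst_reflection {τ τ' : ℝ} (h : cos τ ≤ cos τ') {z : ℝ × ℝ}
    (hz : proj τ' z < proj τ z) : z.1 ≤ (reflection (τ + τ') z).1 := by
  -- In terms of the bisecting angle `p` and the half-opening `d`, the three differences involved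
  -- are products of `sin d`, `sin p` and the coordinate of `z` orthogonal to the mirror.
  obtain ⟨p, d, rfl, rfl⟩ : ∃ p d, τ = p + d ∧ τ' = p - d :=
    ⟨(τ + τ') / 2, (τ - τ') / 2, by ring, by ring⟩
  set n := sin p * z.1 - cos p * z.2 with hn
  have h1 : 0 ≤ sin d * sin p := by rw [cos_add, cos_sub] at h; linarith
  have h2 : sin d * n < 0 := by
    simp only [proj, cos_add, cos_sub, sin_add, sin_sub] at hz
    linarith
  have h3 : (reflection (p + d + (p - d)) z).1 - z.1 = -2 * (sin p * n) := by
    have : p + d + (p - d) = 2 * p := by ring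
    rw [this, reflection, cos_two_mul, sin_two_mul]
    simp only
    linear_combination 2 * z.1 * sin_sq_add_cos_sq p
  have h4 : sin p * n ≤ 0 := by
    by_contra! hpos
    have hd : 0 < sin d ^ 2 := by
      have : sin d ≠ 0 := fun h0 => by simp [h0] at h2
      positivity
    nlinarith [mul_nonpos_of_nonneg_of_nonpos h1 h2.le, mul_pos hd hpos]
  linarith

instance isProbabilityMeasure_uniformCircle : IsProbabilityMeasure uniformCircle := by
  have : IsProbabilityMeasure (ProbabilityTheory.cond volume (Set.Ico (0 : ℝ) (2 * π))) :=
    cond_isProbabilityMeasure_of_finite (by simp [pi_pos])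
      (by rw [Real.volume_Ico]; exact ENNReal.ofReal_ne_top)
  exact Measure.isProbabilityMeasure_map (by fun_prop)

theorem uniformCircle_real_apply {s : Set (ℝ × ℝ)} (hs : MeasurableSet s) :
    uniformCircle.real s =
      (2 * π)⁻¹ * ∫ φ in (0 : ℝ)..(2 * π), s.indicator (fun _ => (1 : ℝ)) (cos φ, sin φ) := by
  have hm : Measurable (fun φ : ℝ => (cos φ, sin φ)) := by fun_prop
  have h2 : (0 : ℝ) ≤ 2 * π := by positivity
  rw [uniformCircle, map_measureReal_apply hm hs, measureReal_def, cond_apply measurableSet_Ico,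
    ENNReal.toReal_mul, ENNReal.toReal_inv, Real.volume_Ico, sub_zero, ENNReal.toReal_ofReal h2,
    intervalIntegral.integral_of_le h2, ← integral_Ico_eq_integral_Ioc, ← measureReal_def,
    Set.inter_comm, ← measureReal_restrict_apply (hm hs)]
  congr 1
  exact (integral_indicator_one (hm hs)).symm

theorem map_reflection_uniformCircle (c : ℝ) :
    uniformCircle.map (reflection c) = uniformCircle := by
  have hc := measurable_reflection c
  have := Measure.isProbabilityMeasure_map (μ := uniformCircle) hc.aemeasurable
  refine Measure.ext fun s hs => ?_
  rw [← ENNReal.toReal_eq_toReal_iff' (measure_ne_top _ _) (measure_ne_top _ _)]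
  change (uniformCircle.map (reflection c)).real s = uniformCircle.real s
  rw [map_measureReal_apply hc hs, uniformCircle_real_apply (hc hs), uniformCircle_real_apply hs]
  congr 1
  set g : ℝ → ℝ := fun φ => s.indicator (fun _ => (1 : ℝ)) (cos φ, sin φ) with hg
  have hper : Function.Periodic g (2 * π) := fun φ => by simp [hg]
  have hcomp : ∀ φ, (reflection c ⁻¹' s).indicator (fun _ => (1 : ℝ)) (cos φ, sin φ) =
      g (c - φ) := fun φ => by
    simp only [hg, cos_sub, sin_sub]
    rfl
  simp only [hcomp]
  rw [intervalIntegral.integral_comp_sub_left g c, sub_zero]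
  have := hper.intervalIntegral_add_eq (c - 2 * π) 0
  rwa [sub_add_cancel, zero_add] at this

theorem measurable_radial : Measurable (fun q : ℝ × ℝ × ℝ => (q.1 * q.2.1, q.1 * q.2.2)) := by
  fun_prop

variable (ν : Measure ℝ) [IsProbabilityMeasure ν]

instance isProbabilityMeasure_sphericalLaw : IsProbabilityMeasure (sphericalLaw ν) :=
  Measure.isProbabilityMeasure_map measurable_radial.aemeasurable

theorem measurePreserving_reflection (c : ℝ) :
    MeasurePreserving (reflection c) (sphericalLaw ν) (sphericalLaw ν) := by
  have hc := measurable_reflection c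
  refine ⟨hc, ?_⟩
  have hprod : (ν.prod uniformCircle).map (Prod.map id (reflection c)) =
      ν.prod uniformCircle := by
    rw [← Measure.map_prod_map ν uniformCircle measurable_id hc, Measure.map_id,
      map_reflection_uniformCircle]
  conv_rhs => rw [sphericalLaw, ← hprod, Measure.map_map measurable_radial (by fun_prop)]
  rw [sphericalLaw, Measure.map_map hc measurable_radial]
  congr 1
  ext q <;> simp only [reflection, Function.comp_apply, Prod.map, id] <;> ring

theorem measureReal_reflection (c : ℝ) {s : Set (ℝ × ℝ)} (hs : MeasurableSet s) :
    (sphericalLaw ν).real (reflection c ⁻¹' s) = (sphericalLaw ν).real s :=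
  (measurePreserving_reflection ν c).measureReal_preimage hs.nullMeasurableSet

variable {ν}

theorem measureReal_proj_le (τ σ x : ℝ) :
    (sphericalLaw ν).real {z | σ * proj τ z ≤ x} = (sphericalLaw ν).real {z | σ * z.1 ≤ x} :=
  measureReal_reflection ν τ (s := {z | σ * z.1 ≤ x})
    (measurableSet_le (by fun_prop) measurable_const)

/-- Two projections of a spherical law become more concordant as the angle between their
directions decreases. The reflection exchanging the directions `τ` and `τ'` maps the part of the
first quadrant event that is lost into the part that is gained. -/
theorem measureReal_quadrant_mono {τ τ' : ℝ} (h : cos τ ≤ cos τ') {σ : ℝ} (hσ : 0 ≤ σ) (q x : ℝ) :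
    (sphericalLaw ν).real {z | z.1 ≤ q ∧ σ * proj τ z ≤ x} ≤
      (sphericalLaw ν).real {z | z.1 ≤ q ∧ σ * proj τ' z ≤ x} := by
  have hm : ∀ τ, MeasurableSet {z : ℝ × ℝ | z.1 ≤ q ∧ σ * proj τ z ≤ x} := fun τ =>
    (measurableSet_le measurable_fst measurable_const).inter
      (measurableSet_le ((measurable_proj τ).const_mul σ) measurable_const)
  set E := {z : ℝ × ℝ | z.1 ≤ q ∧ σ * proj τ z ≤ x} with hE
  set E' := {z : ℝ × ℝ | z.1 ≤ q ∧ σ * proj τ' z ≤ x} with hE'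
  have hdiff : (sphericalLaw ν).real (E \ E') ≤ (sphericalLaw ν).real (E' \ E) := by
    rw [← measureReal_reflection ν (τ + τ') ((hm τ).diff (hm τ'))]
    refine measureReal_mono fun z hz => ?_
    simp only [hE, hE', Set.mem_preimage, Set.mem_sdiff, Set.mem_ofPred_eq, proj_reflection,
      add_sub_cancel_left, add_sub_cancel_right, not_and, not_le] at hz ⊢
    have hgt := hz.2 hz.1.1
    have hlt : proj τ' z < proj τ z := lt_of_mul_lt_mul_left (hz.1.2.trans_lt hgt) hσ
    exact ⟨⟨(fst_le_fst_reflection h hlt).trans hz.1.1, hz.1.2⟩, fun _ => hgt⟩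
  have h1 := measureReal_inter_add_sdiff (μ := sphericalLaw ν) (s := E) (hm τ')
  have h2 := measureReal_inter_add_sdiff (μ := sphericalLaw ν) (s := E') (hm τ)
  rw [Set.inter_comm] at h2
  linarith

end Spherical

/-! ### Elliptical distributions -/

section Elliptical

open Real

theorem exists_angle {a b σ : ℝ} (hσ : 0 ≤ σ) (h : a ^ 2 + b ^ 2 = σ ^ 2) :
    ∃ s, a = σ * cos s ∧ b = σ * sin s := by
  have hn : ‖(⟨a, b⟩ : ℂ)‖ = σ := by
    rw [← sq_eq_sq₀ (norm_nonneg _) hσ, Complex.sq_norm, Complex.normSq_mk, ← h]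
    ring
  refine ⟨Complex.arg ⟨a, b⟩, ?_, ?_⟩
  · rw [← hn, Complex.norm_mul_cos_arg]
  · rw [← hn, Complex.norm_mul_sin_arg]

/-- Polar form of a square root of an ellipticity matrix: its rows have lengths `σX` and `σY` and
enclose an angle with cosine `ρ`. A zero second row may be given any direction. -/
theorem exists_angles_of_mul_transpose {A : Matrix (Fin 2) (Fin 2) ℝ} {σX σY ρ : ℝ}
    (hσX : 0 < σX) (hσY : 0 ≤ σY) (hρ : ρ ∈ Set.Icc (-1 : ℝ) 1)
    (hA : A * A.transpose = !![σX ^ 2, σX * σY * ρ; σX * σY * ρ, σY ^ 2]) :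
    ∃ s t, A 0 0 = σX * cos s ∧ A 0 1 = σX * sin s ∧ A 1 0 = σY * cos t ∧ A 1 1 = σY * sin t ∧
      cos (s - t) = ρ := by
  have h00 := congrFun (congrFun hA 0) 0
  have h01 := congrFun (congrFun hA 0) 1
  have h11 := congrFun (congrFun hA 1) 1
  simp only [Matrix.mul_apply, Matrix.transpose_apply, Fin.sum_univ_two, Matrix.of_apply,
    Matrix.cons_val', Matrix.cons_val_zero, Matrix.cons_val_one, Matrix.cons_val_fin_one]
    at h00 h01 h11
  obtain ⟨s, hs0, hs1⟩ := exists_angle hσX.le (a := A 0 0) (b := A 0 1) (by rw [← h00]; ring)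
  rcases hσY.eq_or_lt with h0 | hpos
  · subst h0
    have h10 : A 1 0 = 0 := by nlinarith [sq_nonneg (A 1 0), sq_nonneg (A 1 1)]
    have h11 : A 1 1 = 0 := by nlinarith [sq_nonneg (A 1 0), sq_nonneg (A 1 1)]
    exact ⟨s, s - arccos ρ, hs0, hs1, by simp [h10], by simp [h11], by
      rw [sub_sub_cancel, cos_arccos hρ.1 hρ.2]⟩
  · obtain ⟨t, ht0, ht1⟩ := exists_angle hpos.le (a := A 1 0) (b := A 1 1) (by rw [← h11]; ring)
    refine ⟨s, t, hs0, hs1, ht0, ht1, ?_⟩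
    rw [hs0, hs1, ht0, ht1] at h01
    have hne : σX * σY ≠ 0 := (mul_pos hσX hpos).ne'
    rw [cos_sub]
    refine mul_left_cancel₀ hne ?_
    linarith

theorem ellipticalLaw_eq_map (mX mY : ℝ) (A : Matrix (Fin 2) (Fin 2) ℝ) (ν : Measure ℝ) :
    ellipticalLaw mX mY A ν = (sphericalLaw ν).map
      (fun z => (mX + (A 0 0 * z.1 + A 0 1 * z.2), mY + (A 1 0 * z.1 + A 1 1 * z.2))) := by
  rw [ellipticalLaw, sphericalLaw, Measure.map_map (by fun_prop) measurable_radial]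
  congr 1
  ext q <;> simp only [Function.comp_apply] <;> ring

/-- A margin of location `m` and scale `σ = 0` is a point mass at `m`, whose distribution function
jumps there. -/
theorem pos_of_continuous_margin {μ : Measure (ℝ × ℝ)} [IsProbabilityMeasure μ] {m σ : ℝ}
    {F : ℝ → ℝ} (hσ : 0 ≤ σ) (hF : Continuous F)
    (h : ∀ y, F y = μ.real {z | σ * z.1 ≤ y - m}) : 0 < σ := by
  refine hσ.lt_of_ne fun h0 => ?_
  subst h0
  have hm : F m = 1 := by simp [h]
  have hlt : ∀ y ∈ Set.Iio m, F y ≤ 0 := fun y hy => by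
    have : ¬ m ≤ y := not_le.2 hy
    simp [h, this]
  have := le_of_tendsto (hF.continuousAt.mono_left (nhdsWithin_le_nhds (a := m) (s := Set.Iio m)))
    (eventually_mem_nhdsWithin.mono hlt)
  linarith

namespace IsElliptical

variable {Q : Measure (ℝ × ℝ)} {mX mY σX σY ρ : ℝ} {ν : Measure ℝ}

theorem isProbabilityMeasure (h : IsElliptical Q mX mY σX σY ρ ν) : IsProbabilityMeasure Q := by
  have := h.isProbabilityMeasure_radial
  obtain ⟨A, -, rfl⟩ := h.law_eq
  rw [ellipticalLaw_eq_map]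
  exact Measure.isProbabilityMeasure_map (by fun_prop)

theorem cdf_fst (h : IsElliptical Q mX mY σX σY ρ ν) (x : ℝ) :
    cdf (Q.map Prod.fst) x = (sphericalLaw ν).real {z | σX * z.1 ≤ x - mX} := by
  have := h.isProbabilityMeasure_radial
  have := h.isProbabilityMeasure
  obtain ⟨A, hA, hQ⟩ := h.law_eq
  have h00 := congrFun (congrFun hA 0) 0
  simp only [Matrix.mul_apply, Matrix.transpose_apply, Fin.sum_univ_two, Matrix.of_apply,
    Matrix.cons_val', Matrix.cons_val_zero, Matrix.cons_val_fin_one] at h00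
  obtain ⟨s, hs0, hs1⟩ := exists_angle h.scaleX_nonneg (a := A 0 0) (b := A 0 1)
    (by rw [← h00]; ring)
  rw [cdf_map_eq_real measurable_fst, ← measureReal_proj_le s, hQ, ellipticalLaw_eq_map,
    map_measureReal_apply (by fun_prop) (measurableSet_le measurable_fst measurable_const)]
  congr 1
  ext z
  simp only [Set.mem_preimage, Set.mem_ofPred_eq, hs0, hs1, proj, le_sub_iff_add_le']
  ring_nf

theorem cdf_snd (h : IsElliptical Q mX mY σX σY ρ ν) (y : ℝ) :
    cdf (Q.map Prod.snd) y = (sphericalLaw ν).real {z | σY * z.1 ≤ y - mY} := by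
  have := h.isProbabilityMeasure_radial
  have := h.isProbabilityMeasure
  obtain ⟨A, hA, hQ⟩ := h.law_eq
  have h11 := congrFun (congrFun hA 1) 1
  simp only [Matrix.mul_apply, Matrix.transpose_apply, Fin.sum_univ_two, Matrix.of_apply,
    Matrix.cons_val', Matrix.cons_val_one, Matrix.cons_val_fin_one] at h11
  obtain ⟨s, hs0, hs1⟩ := exists_angle h.scaleY_nonneg (a := A 1 0) (b := A 1 1)
    (by rw [← h11]; ring)
  rw [cdf_map_eq_real measurable_snd, ← measureReal_proj_le s, hQ, ellipticalLaw_eq_map,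
    map_measureReal_apply (by fun_prop) (measurableSet_le measurable_snd measurable_const)]
  congr 1
  ext z
  simp only [Set.mem_preimage, Set.mem_ofPred_eq, hs0, hs1, proj, le_sub_iff_add_le']
  ring_nf

theorem scaleX_pos (h : IsElliptical Q mX mY σX σY ρ ν) (hQ : Continuous (cdf (Q.map Prod.fst))) :
    0 < σX :=
  have := h.isProbabilityMeasure_radial
  pos_of_continuous_margin h.scaleX_nonneg hQ h.cdf_fst

theorem scaleY_pos (h : IsElliptical Q mX mY σX σY ρ ν) (hQ : Continuous (cdf (Q.map Prod.snd))) :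
    0 < σY :=
  have := h.isProbabilityMeasure_radial
  pos_of_continuous_margin h.scaleY_nonneg hQ h.cdf_snd

/-- The distribution function of the first coordinate of the spherical law is the standardization
of the one of the first margin. -/
theorem cdf_fst_eq (h : IsElliptical Q mX mY σX σY ρ ν) (hσX : 0 < σX) (x : ℝ) :
    cdf (Q.map Prod.fst) x = cdf ((sphericalLaw ν).map Prod.fst) ((x - mX) / σX) := by
  have := h.isProbabilityMeasure_radial
  rw [h.cdf_fst, cdf_map_eq_real measurable_fst]
  simp only [le_div_iff₀' hσX]

theorem cdf_snd_eq (h : IsElliptical Q mX mY σX σY ρ ν) (hσY : 0 < σY) (y : ℝ) :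
    cdf (Q.map Prod.snd) y = cdf ((sphericalLaw ν).map Prod.fst) ((y - mY) / σY) := by
  have := h.isProbabilityMeasure_radial
  rw [h.cdf_snd, cdf_map_eq_real measurable_fst]
  simp only [le_div_iff₀' hσY]

theorem continuous_cdf_spherical (h : IsElliptical Q mX mY σX σY ρ ν)
    (hQ : Continuous (cdf (Q.map Prod.fst))) :
    Continuous (cdf ((sphericalLaw ν).map Prod.fst)) := by
  have hpos := h.scaleX_pos hQ
  have heq : ⇑(cdf ((sphericalLaw ν).map Prod.fst)) =
      fun s => cdf (Q.map Prod.fst) (mX + σX * s) := by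
    ext s
    rw [h.cdf_fst_eq hpos, add_sub_cancel_left, mul_div_cancel_left₀ _ hpos.ne']
  rw [heq]
  exact hQ.comp (by fun_prop)

/-- The joint distribution function of an elliptical law, in terms of the spherical law and an
angle with cosine `ρ`. -/
theorem exists_jointCDF_eq (h : IsElliptical Q mX mY σX σY ρ ν) (hσX : 0 < σX) :
    ∃ τ, cos τ = ρ ∧ ∀ q y, jointCDF Q (mX + σX * q) y =
      (sphericalLaw ν).real {z | z.1 ≤ q ∧ σY * proj τ z ≤ y - mY} := by
  have := h.isProbabilityMeasure_radial
  obtain ⟨A, hA, hQ⟩ := h.law_eq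
  obtain ⟨s, t, hs0, hs1, ht0, ht1, hst⟩ :=
    exists_angles_of_mul_transpose hσX h.scaleY_nonneg h.rho_mem hA
  refine ⟨s - t, hst, fun q y => ?_⟩
  have hm : MeasurableSet {z : ℝ × ℝ | proj s z ≤ q ∧ σY * proj t z ≤ y - mY} :=
    (measurableSet_le (measurable_proj s) measurable_const).inter
      (measurableSet_le ((measurable_proj t).const_mul σY) measurable_const)
  have hrefl := measureReal_reflection ν s hm
  simp only [Set.preimage_ofPred_eq, proj_reflection, sub_self, proj_zero] at hrefl
  rw [hrefl, jointCDF, hQ, ellipticalLaw_eq_map,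
    map_measureReal_apply (by fun_prop) (measurableSet_Iic.prod measurableSet_Iic)]
  congr 1
  ext z
  simp only [Set.mem_preimage, Set.mem_prod, Set.mem_Iic, Set.mem_ofPred_eq, hs0, hs1, ht0, ht1,
    mul_assoc, ← mul_add, add_le_add_iff_left, le_sub_iff_add_le']
  rw [mul_le_mul_iff_right₀ hσX]
  rfl

/-- An elliptical law with an atomless first margin is symmetric and atomless, so its location
parameter is a median of its second margin. -/
theorem cdf_snd_location (h : IsElliptical Q mX mY σX σY ρ ν)
    (hQ : Continuous (cdf (Q.map Prod.fst))) (hσY : 0 < σY) :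
    cdf (Q.map Prod.snd) mY = 1 / 2 := by
  have := h.isProbabilityMeasure_radial
  have := Measure.isProbabilityMeasure_map (μ := sphericalLaw ν) measurable_fst.aemeasurable
  rw [h.cdf_snd_eq hσY, sub_self, zero_div, cdf_map_eq_real measurable_fst]
  have hm : MeasurableSet {z : ℝ × ℝ | z.1 ≤ 0} :=
    measurableSet_le measurable_fst measurable_const
  have hrefl : (sphericalLaw ν).real {z | 0 ≤ z.1} = (sphericalLaw ν).real {z | z.1 ≤ 0} := by
    rw [← measureReal_reflection ν π hm]
    congr 1
    ext z
    simp [reflection]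
  have h0 : ∀ᵐ z ∂(sphericalLaw ν), z.1 ≠ 0 := by
    have : (sphericalLaw ν) (Prod.fst ⁻¹' {0}) = 0 := by
      rw [← Measure.map_apply measurable_fst (measurableSet_singleton _)]
      exact measure_singleton_of_continuous_cdf (h.continuous_cdf_spherical hQ) 0
    simp only [ae_iff, not_not]
    exact this
  have hae : {z : ℝ × ℝ | 0 ≤ z.1} =ᵐ[sphericalLaw ν] ({z | z.1 ≤ 0}ᶜ : Set (ℝ × ℝ)) := by
    filter_upwards [h0] with z hz
    exact propext ⟨fun h => not_le.2 (lt_of_le_of_ne h hz.symm), fun h => le_of_not_ge h⟩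
  rw [measureReal_congr hae, probReal_compl_eq_one_sub hm] at hrefl
  linarith

end IsElliptical

/-- Elliptical copulas of a common type increase with the dependence parameter. -/
theorem IsEllipticalCopula.le {C C' : ℝ → ℝ → ℝ} {ρ ρ' : ℝ} {ν : Measure ℝ}
    (hC : IsEllipticalCopula C ρ ν) (hC' : IsEllipticalCopula C' ρ' ν) (hρ : ρ ≤ ρ')
    {u v : ℝ} (hu : u ∈ Set.Ioo (0 : ℝ) 1) (hv : v ∈ Set.Ioo (0 : ℝ) 1) : C u v ≤ C' u v := by
  -- Both copulas are evaluated through the standardized spherical law.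
  have key : ∀ {C : ℝ → ℝ → ℝ} {ρ : ℝ}, IsEllipticalCopula C ρ ν →
      Continuous (cdf ((sphericalLaw ν).map Prod.fst)) ∧ ∃ τ, cos τ = ρ ∧ ∀ q x,
        C (cdf ((sphericalLaw ν).map Prod.fst) q) (cdf ((sphericalLaw ν).map Prod.fst) x) =
          (sphericalLaw ν).real {z | z.1 ≤ q ∧ 1 * proj τ z ≤ x} := by
    rintro C ρ ⟨Q, mX, mY, σX, σY, hQ, hc1, hc2, hCQ⟩
    have hX := hQ.scaleX_pos hc1
    have hY := hQ.scaleY_pos hc2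
    obtain ⟨τ, hτ, hj⟩ := hQ.exists_jointCDF_eq hX
    refine ⟨hQ.continuous_cdf_spherical hc1, τ, hτ, fun q x => ?_⟩
    have h1 := hQ.cdf_fst_eq hX (mX + σX * q)
    have h2 := hQ.cdf_snd_eq hY (mY + σY * x)
    rw [add_sub_cancel_left, mul_div_cancel_left₀ _ hX.ne'] at h1
    rw [add_sub_cancel_left, mul_div_cancel_left₀ _ hY.ne'] at h2
    rw [← h1, ← h2, ← hCQ.2, hj]
    simp only [add_sub_cancel_left, mul_le_mul_iff_right₀ hY, one_mul]
  obtain ⟨hcont, τ, rfl, hτ⟩ := key hC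
  obtain ⟨-, τ', rfl, hτ'⟩ := key hC'
  have hν : IsProbabilityMeasure ν := by
    obtain ⟨Q, mX, mY, σX, σY, hQ, -⟩ := hC
    exact hQ.isProbabilityMeasure_radial
  rw [← cdf_genInv_of_continuous _ hcont hu, ← cdf_genInv_of_continuous _ hcont hv, hτ, hτ']
  exact measureReal_quadrant_mono hρ zero_le_one _ _

/-- The probability, under the spherical law of type `ν`, that the first coordinate exceeds `q`
and `σ` times the coordinate in direction `τ` is at most `x`. -/
noncomputable def sphericalTail (ν : Measure ℝ) (q τ σ x : ℝ) : ℝ :=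
  (sphericalLaw ν).real {z | q < z.1 ∧ σ * proj τ z ≤ x}

section Tail

variable {ν : Measure ℝ}

theorem sphericalTail_mul (q τ : ℝ) {σ : ℝ} (hσ : 0 < σ) (x : ℝ) :
    sphericalTail ν q τ σ (σ * x) = sphericalTail ν q τ 1 x := by
  simp only [sphericalTail, mul_le_mul_iff_right₀ hσ, one_mul]

variable [IsProbabilityMeasure ν]

theorem sphericalTail_mono (q τ σ : ℝ) {x x' : ℝ} (h : x ≤ x') :
    sphericalTail ν q τ σ x ≤ sphericalTail ν q τ σ x' :=
  measureReal_mono fun _ hz => ⟨hz.1, hz.2.trans h⟩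

theorem sphericalTail_eq_sub (q τ σ x : ℝ) :
    sphericalTail ν q τ σ x = (sphericalLaw ν).real {z | σ * z.1 ≤ x} -
      (sphericalLaw ν).real {z | z.1 ≤ q ∧ σ * proj τ z ≤ x} := by
  rw [sphericalTail, eq_sub_iff_add_eq, ← measureReal_proj_le τ, ← measureReal_union]
  · congr 1
    ext z
    simp only [Set.mem_union, Set.mem_ofPred_eq, ← or_and_right, lt_or_ge, true_and]
  · exact Set.disjoint_left.2 fun z h h' => not_lt.2 h'.1 h.1
  · exact (measurableSet_le measurable_fst measurable_const).inter
      (measurableSet_le ((measurable_proj τ).const_mul σ) measurable_const)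

theorem sphericalTail_antitone {τ τ' : ℝ} (h : cos τ ≤ cos τ') {σ : ℝ} (hσ : 0 ≤ σ) (q x : ℝ) :
    sphericalTail ν q τ' σ x ≤ sphericalTail ν q τ σ x := by
  rw [sphericalTail_eq_sub, sphericalTail_eq_sub]
  exact sub_le_sub_left (measureReal_quadrant_mono h hσ q x) _

end Tail

variable {Ω Ω' : Type*} [MeasurableSpace Ω] [MeasurableSpace Ω']
  {P : Measure Ω} {P' : Measure Ω'} [IsProbabilityMeasure P] [IsProbabilityMeasure P']
  {X Y : Ω → ℝ} {X' Y' : Ω' → ℝ} {mX mY σX σY ρ mX' mY' σX' σY' ρ' : ℝ} {ν : Measure ℝ}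

/-- The conditional law of `Y` given the stress event of `X`, for an elliptical pair `(X, Y)`. The
threshold for the spherical law depends only on the radial part and on `α`. -/
theorem IsElliptical.exists_cdf_stressed_eq (h : IsElliptical (jointLaw P X Y) mX mY σX σY ρ ν)
    (hX : Measurable X) (hY : Measurable Y) (hFX : Continuous (cdf (P.map X))) :
    ∃ τ, cos τ = ρ ∧ ∀ α ∈ Set.Ioo (0 : ℝ) 1, ∀ y, cdf ((stressed P X α).map Y) y =
      sphericalTail ν (genInv (cdf ((sphericalLaw ν).map Prod.fst)) α) τ σY (y - mY) /
        (1 - α) := by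
  have := h.isProbabilityMeasure_radial
  have hσX : 0 < σX := h.scaleX_pos (by rwa [map_fst_jointLaw hX hY])
  obtain ⟨τ, hτ, hj⟩ := h.exists_jointCDF_eq hσX
  refine ⟨τ, hτ, fun α hα y => ?_⟩
  have hVaR : VaR P X α = mX + σX * genInv (cdf ((sphericalLaw ν).map Prod.fst)) α := by
    rw [VaR, ← map_fst_jointLaw hX hY]
    exact genInv_cdf_comp_affine hσX (h.cdf_fst_eq hσX) hα
  rw [cdf_map_stressed hX hY hFX hα, hVaR, hj, ← map_snd_jointLaw hX hY, h.cdf_snd,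
    ← sphericalTail_eq_sub]

/-- With equal scales and ordered locations and dependence parameters, the conditional laws are
stochastically ordered; this includes the degenerate case of scale zero, in which no copula is
determined. -/
theorem IsElliptical.cdf_stressed_le (h : IsElliptical (jointLaw P X Y) mX mY σX σY ρ ν)
    (h' : IsElliptical (jointLaw P' X' Y') mX' mY' σX' σY ρ' ν)
    (hX : Measurable X) (hY : Measurable Y) (hX' : Measurable X') (hY' : Measurable Y')
    (hFX : Continuous (cdf (P.map X))) (hFX' : Continuous (cdf (P'.map X')))
    (hm : mY ≤ mY') (hρ : ρ ≤ ρ') {α : ℝ} (hα : α ∈ Set.Ioo (0 : ℝ) 1) (y : ℝ) :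
    cdf ((stressed P' X' α).map Y') y ≤ cdf ((stressed P X α).map Y) y := by
  have := h.isProbabilityMeasure_radial
  obtain ⟨τ, rfl, hG⟩ := h.exists_cdf_stressed_eq hX hY hFX
  obtain ⟨τ', rfl, hG'⟩ := h'.exists_cdf_stressed_eq hX' hY' hFX'
  rw [hG α hα, hG' α hα]
  refine div_le_div_of_nonneg_right ?_ (sub_nonneg.2 hα.2.le)
  exact (sphericalTail_antitone hρ h.scaleY_nonneg _ _).trans
    (sphericalTail_mono _ _ _ (by linarith))

/-- With ordered scales, the conditional quantiles of elliptical pairs are ordered at all levels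
above the conditional probability of `{Y ≤ mY}`: there the standardized conditional quantile is
non-negative, so that enlarging the scale increases the quantile. -/
theorem IsElliptical.CoVaR_le (h : IsElliptical (jointLaw P X Y) mX mY σX σY ρ ν)
    (h' : IsElliptical (jointLaw P' X' Y') mX' mY' σX' σY' ρ' ν)
    (hX : Measurable X) (hY : Measurable Y) (hX' : Measurable X') (hY' : Measurable Y')
    (hFX : Continuous (cdf (P.map X))) (hFX' : Continuous (cdf (P'.map X')))
    (hσ : 0 < σY) (hm : mY ≤ mY') (hσσ' : σY ≤ σY') (hρ : ρ ≤ ρ') {α t : ℝ}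
    (hα : α ∈ Set.Ioo (0 : ℝ) 1) (ht : t ∈ Set.Ioo (cdf ((stressed P X α).map Y) mY) 1) :
    CoVaR P Y X α t ≤ CoVaR P' Y' X' α t := by
  have := h.isProbabilityMeasure_radial
  have hσ' : 0 < σY' := hσ.trans_le hσσ'
  obtain ⟨τ, rfl, hG⟩ := h.exists_cdf_stressed_eq hX hY hFX
  obtain ⟨τ', rfl, hG'⟩ := h'.exists_cdf_stressed_eq hX' hY' hFX'
  refine CoVaR_le_of_forall ⟨(cdf_nonneg _ _).trans_lt ht.1, ht.2⟩ fun y hy => ?_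
  have hα1 : 0 < 1 - α := sub_pos.2 hα.2
  have ht0 := ht.1
  rw [hG α hα, sub_self, ← mul_zero σY, sphericalTail_mul _ _ hσ, div_lt_iff₀ hα1] at ht0
  rw [hG' α hα, le_div_iff₀ hα1, ← mul_div_cancel₀ (y - mY') hσ'.ne',
    sphericalTail_mul _ _ hσ'] at hy
  rw [hG α hα, le_div_iff₀ hα1]
  set q := genInv (cdf ((sphericalLaw ν).map Prod.fst)) α
  set s := (y - mY') / σY' with hs
  replace hy := hy.trans (sphericalTail_antitone hρ zero_le_one q s)
  have hs0 : 0 < s := lt_of_not_ge fun hle =>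
    not_lt.2 (hy.trans (sphericalTail_mono q τ 1 hle)) ht0
  have hys : σY' * s = y - mY' := by rw [hs, mul_div_cancel₀ _ hσ'.ne']
  have hle : σY * s ≤ y - mY := by nlinarith
  refine hy.trans ?_
  rw [← sphericalTail_mul q τ hσ]
  exact sphericalTail_mono q τ σY hle

end Elliptical

/-! ### Ordering of the conditional risk measures -/

theorem corollary2
    {Ω Ω' : Type*} [MeasurableSpace Ω] [MeasurableSpace Ω']
    (P : Measure Ω) (P' : Measure Ω') [IsProbabilityMeasure P] [IsProbabilityMeasure P']
    (X Y : Ω → ℝ) (X' Y' : Ω' → ℝ)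
    (hX : Measurable X) (hY : Measurable Y) (hX' : Measurable X') (hY' : Measurable Y')
    (hYint : Integrable Y P) (hYint' : Integrable Y' P')
    (hFX : Continuous (cdf (P.map X))) (hFX' : Continuous (cdf (P'.map X'))) :
    -- the integrals that define the conditional expected shortfalls converge
    (∀ α ∈ Set.Ioo (0 : ℝ) 1,
      IntervalIntegrable (fun t => CoVaR P Y X α t) volume 0 1 ∧
      IntervalIntegrable (fun t => CoVaR P' Y' X' α t) volume 0 1) ∧
    -- full ordering, under each of three sets of assumptions
    ( -- elliptical distributions with the same radial part
      ((∃ (mX mY σX σY ρ mX' mY' σX' σY' ρ' : ℝ) (ν : Measure ℝ),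
        IsElliptical (jointLaw P X Y) mX mY σX σY ρ ν ∧
        IsElliptical (jointLaw P' X' Y') mX' mY' σX' σY' ρ' ν ∧
        mY ≤ mY' ∧ σY = σY' ∧ ρ ≤ ρ') ∨
      -- elliptical copulas of the same type
      (∃ (C C' : ℝ → ℝ → ℝ) (ρ ρ' : ℝ) (ν : Measure ℝ),
        IsEllipticalCopula C ρ ν ∧ IsEllipticalCopula C' ρ' ν ∧
        IsCopulaOf C (jointLaw P X Y) ∧ IsCopulaOf C' (jointLaw P' X' Y') ∧
        (∀ y : ℝ, cdf (P'.map Y') y ≤ cdf (P.map Y) y) ∧ ρ ≤ ρ') ∨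
      -- Gumbel copulas
      (∃ θ θ' : ℝ≥0∞,
        1 ≤ θ ∧
        IsCopulaOf (gumbelCopula θ) (jointLaw P X Y) ∧
        IsCopulaOf (gumbelCopula θ') (jointLaw P' X' Y') ∧
        (∀ y : ℝ, cdf (P'.map Y') y ≤ cdf (P.map Y) y) ∧ θ ≤ θ')) →
      (∀ α ∈ Set.Ioo (0 : ℝ) 1, ∀ β ∈ Set.Ioo (0 : ℝ) 1,
        CoES P Y X α β ≤ CoES P' Y' X' α β) ∧
      (∀ α ∈ Set.Ioo (0 : ℝ) 1, MES P Y X α ≤ MES P' Y' X' α)) ∧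
    -- ordering for `β ≥ β₀`, for elliptical distributions with ordered scales
    (∀ (mX mY σX σY ρ mX' mY' σX' σY' ρ' : ℝ) (ν : Measure ℝ),
      IsElliptical (jointLaw P X Y) mX mY σX σY ρ ν →
      IsElliptical (jointLaw P' X' Y') mX' mY' σX' σY' ρ' ν →
      0 < σY → mY ≤ mY' → σY ≤ σY' → ρ ≤ ρ' →
      ∀ C : ℝ → ℝ → ℝ, IsCopulaOf C (jointLaw P X Y) →
      ∀ α ∈ Set.Ioo (0 : ℝ) 1, ∀ β ∈ Set.Ico ((1 / 2 - C α (1 / 2)) / (1 - α)) 1,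
        CoES P Y X α β ≤ CoES P' Y' X' α β) := by
  refine ⟨fun α hα => ⟨intervalIntegrable_CoVaR hX hY hYint hFX hα,
    intervalIntegrable_CoVaR hX' hY' hYint' hFX' hα⟩, fun h => ?_, ?_⟩
  · refine CoES_le_and_MES_le_of_cdf_le hX hY hX' hY' hYint hYint' hFX hFX' ?_
    rcases h with ⟨mX, mY, σX, σY, ρ, mX', mY', σX', σY', ρ', ν, h, h', hm, rfl, hρ⟩ |
      ⟨C, C', ρ, ρ', ν, hE, hE', hC, hC', hF, hρ⟩ | ⟨θ, θ', hθ, hC, hC', hF, hθθ'⟩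
    · exact fun α hα y => h.cdf_stressed_le h' hX hY hX' hY' hFX hFX' hm hρ hα y
    · exact fun α hα y => cdf_stressed_le_of_copula_le hX hY hX' hY' hFX hFX' hC hC'
        (fun u hu v hv => hE.le hE' hρ hu hv) hF hα y
    · exact fun α hα y => cdf_stressed_le_of_copula_le hX hY hX' hY' hFX hFX' hC hC'
        (fun u hu v hv => gumbelCopula_le_gumbelCopula hθ hθθ' hC.1 hu hv) hF hα y
  · intro mX mY σX σY ρ mX' mY' σX' σY' ρ' ν h h' hσ hm hσσ' hρ C hC α hα β hβ
    have hmedian : cdf (P.map Y) mY = 1 / 2 := by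
      rw [← map_snd_jointLaw hX hY]
      exact h.cdf_snd_location (by rwa [map_fst_jointLaw hX hY]) hσ
    -- The bound on `β` is the conditional probability of `{Y ≤ mY}` given the stress event.
    have hβ0 : (1 / 2 - C α (1 / 2)) / (1 - α) = cdf ((stressed P X α).map Y) mY := by
      rw [cdf_map_stressed hX hY hFX hα, hC.jointCDF_VaR hX hY hFX hα, hmedian]
    rw [hβ0] at hβ
    exact CoES_le_of_CoVaR_le ⟨(cdf_nonneg _ _).trans hβ.1, hβ.2⟩
      (intervalIntegrable_CoVaR hX hY hYint hFX hα)
      (intervalIntegrable_CoVaR hX' hY' hYint' hFX' hα)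
      fun t ht => h.CoVaR_le h' hX hY hX' hY' hFX hFX' hσ hm hσσ' hρ hα
        ⟨hβ.1.trans_lt ht.1, ht.2⟩
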